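/- Let $i,n$ be integers with $1\le i<n$ and put $j=n-i$. For $k\ge 1$ let $D_k$ be the set of sequences $((a_l,b_l))_{1\le l\le k}$ of pairs of positive integers such that $$\sum_{l=1}^k a_l=i,\qquad \sum_{l=1}^k b_l=n,\qquad 1>\frac{a_1}{b_1}>\cdots>\frac{a_k}{b_k}>0 .$$ Then, as an identity of Laurent polynomials with integer coefficients in $q^{1/2}$, where $q$ is an indeterminate (and hence also for every real number $q>0$, with real powers), $$\sum_{k\ge 1}\ \sum_{((a_l,b_l))_{l\le k}\in D_k}(q-1)^{k-1}\,q^{\,1-k+\frac12\left(\sum_{1\le l_1<l_2\le k}(a_{l_1}b_{l_2}-a_{l_2}b_{l_1})+\sum_{1\le l\le k}\gcd(a_l,b_l)\right)}=q^{\frac{ij-n}{2}+1}.$$ Only finitely many $D_k$ are non-empty and each is finite, so the sum is finite. -/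

import Mathlib

noncomputable section

namespace SlopeIdentity

/-- The set `D_k`: sequences of `k` pairs `(a_l, b_l)` of positive integers with `∑ a_l = i`,
`∑ b_l = n` and `1 > a_1 / b_1 > ⋯ > a_k / b_k > 0`. The slopes are taken in `ℚ`. -/
def D (i n k : ℕ) : Set (Fin k → ℕ × ℕ) :=
  {s | (∀ l, 0 < (s l).1 ∧ 0 < (s l).2) ∧
    ∑ l, (s l).1 = i ∧ ∑ l, (s l).2 = n ∧
    StrictAnti (fun l => ((s l).1 : ℚ) / ((s l).2 : ℚ)) ∧
    ∀ l, 0 < ((s l).1 : ℚ) / ((s l).2 : ℚ) ∧ ((s l).1 : ℚ) / ((s l).2 : ℚ) < 1}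

/-- The index set of the sum: all pairs of a length `k ≥ 1` and an element of `D_k`. -/
def indexSet (i n : ℕ) : Set (Σ k : ℕ, Fin k → ℕ × ℕ) :=
  {s | 1 ≤ s.1 ∧ s.2 ∈ D i n s.1}

theorem indexSet_finite (i n : ℕ) : (indexSet i n).Finite := by
  refine Set.Finite.subset (Finset.finite_toSet ((Finset.range (i + 1)).sigma fun k =>
    Fintype.piFinset fun _ : Fin k => Finset.range (i + 1) ×ˢ Finset.range (n + 1))) ?_
  rintro ⟨k, s⟩ ⟨-, hpos, ha, hb, -⟩
  dsimp only at hpos ha hb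
  have hk : k ≤ i := by
    calc k = ∑ _l : Fin k, 1 := by simp
      _ ≤ ∑ l, (s l).1 := Finset.sum_le_sum fun l _ => (hpos l).1
      _ = i := ha
  have h1 : ∀ l, (s l).1 ≤ i := fun l =>
    ha ▸ Finset.single_le_sum (f := fun l => (s l).1) (fun _ _ => Nat.zero_le _)
      (Finset.mem_univ l)
  have h2 : ∀ l, (s l).2 ≤ n := fun l =>
    hb ▸ Finset.single_le_sum (f := fun l => (s l).2) (fun _ _ => Nat.zero_le _)
      (Finset.mem_univ l)
  simp only [Finset.coe_sigma, Set.mem_sigma_iff, Finset.mem_coe, Finset.mem_range,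
    Fintype.mem_piFinset, Finset.mem_product]
  exact ⟨by omega, fun l => ⟨Nat.lt_succ_of_le (h1 l), Nat.lt_succ_of_le (h2 l)⟩⟩

/-- The exponent
`1 - k + (∑_{l₁ < l₂} (a_{l₁} b_{l₂} - a_{l₂} b_{l₁}) + ∑_l gcd (a_l, b_l)) / 2` as a rational
number. -/
def exponent {k : ℕ} (s : Fin k → ℕ × ℕ) : ℚ :=
  1 - (k : ℚ) +
    ((∑ l₁ : Fin k, ∑ l₂ ∈ Finset.Ioi l₁,
        (((s l₁).1 : ℚ) * ((s l₂).2 : ℚ) - ((s l₂).1 : ℚ) * ((s l₁).2 : ℚ))) +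
      ∑ l : Fin k, (Nat.gcd (s l).1 (s l).2 : ℚ)) / 2

/-- The formal power `q ^ r` of an indeterminate `q`, for a rational exponent `r`, as an element of
the ring `ℤ[q ^ r : r ∈ ℚ]`, the group ring of `(ℚ, +)`: the `q ^ r` form a `ℤ`-basis, and
`q ^ r * q ^ r' = q ^ (r + r')`. This ring contains the ring of Laurent polynomials in
`q ^ (1 / 2)`. -/
def qPow (r : ℚ) : AddMonoidAlgebra ℤ ℚ := AddMonoidAlgebra.single r 1

end SlopeIdentity

end

/-!
The shear `(a, b) ↦ (a, b - a)` turns the sequences in the sum into the strictly convex lattice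
paths from the origin to `(i, j)` with positive steps. Choose every lattice point strictly inside
the triangle with vertices `(0, 0)`, `(i, 0)` and `(i, j)` independently with probability
`1 - q⁻¹`. A path with `k` steps is the lower convex hull of the chosen points and the two end
points exactly when its `k - 1` inner vertices are chosen and the points of the triangle below it
are not, so this has probability `(1 - q⁻¹) ^ (k - 1) * q ^ (-B)`, where `B` is the number of points
below the path. A count in the style of Pick's theorem expresses `B` through the cross products and
gcds of the steps and shows that this probability is the summand divided by the right-hand side.

That the probabilities add up to `1` is a polynomial identity, valid in every commutative ring. Its
proof is by induction on the set of available points, conditioning on whether the first hull vertex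
after the start is chosen.
-/

namespace SlopeIdentity

section ConvexPaths

variable {K : Type*} [CommRing K]

/-- The cross product of two plane vectors. For vectors with positive first coordinate it is
positive exactly when the second one has the larger slope. -/
def cross (p q : K × K) : K := p.1 * q.2 - q.1 * p.2

theorem cross_self (p : K × K) : cross p p = 0 :=
  sub_self _

theorem neg_cross (p q : K × K) : -cross p q = cross q p :=
  neg_sub _ _

theorem cross_add_right (p q r : K × K) : cross p (q + r) = cross p q + cross p r := by
  simp only [cross, Prod.fst_add, Prod.snd_add]
  ring

theorem cross_sub_add_self (p q r : K × K) : cross p (q - (r + p)) = cross p (q - r) := by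
  simp only [cross, Prod.fst_sub, Prod.snd_sub, Prod.fst_add, Prod.snd_add]
  ring

theorem mul_cross (p q r : K × K) : q.1 * cross p r = r.1 * cross p q + p.1 * cross q r := by
  simp only [cross]
  ring

variable [LinearOrder K]

/-- The point `p` lies strictly below the open chord from `v` to `e`. -/
def BelowChord (v e p : K × K) : Prop :=
  v.1 < p.1 ∧ p.1 < e.1 ∧ 0 < cross (p - v) (e - v)

/-- `L` is the list of steps of a strictly convex path from `v` to `e`, running from left to right
and with all inner vertices in `M`. -/
inductive IsConvexPath (e : K × K) (M : Finset (K × K)) : K × K → List (K × K) → Prop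
  | single {v s : K × K} (hs : 0 < s.1) (he : v + s = e) : IsConvexPath e M v [s]
  | cons {v s : K × K} {L : List (K × K)} (hs : 0 < s.1) (hM : v + s ∈ M)
      (hL : ∀ r ∈ L, 0 < cross s r) (h : IsConvexPath e M (v + s) L) : IsConvexPath e M v (s :: L)

/-- The step lists of all strictly convex paths from `v` to `e` with inner vertices in `M`. -/
def convexPaths (e : K × K) (M : Finset (K × K)) (v : K × K) : Set (List (K × K)) :=
  {L | IsConvexPath e M v L}

/-- The point `p` lies strictly below the path that starts at `v` and has step list `L`, for `p`
in the half-open strip between the start (excluded) and the end (included) of the path. -/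
def Below : K × K → List (K × K) → K × K → Prop
  | _, [], _ => False
  | v, s :: L, p => if p.1 ≤ v.1 + s.1 then 0 < cross (p - v) s else Below (v + s) L p

/-- A ray that turns counterclockwise from the downward direction meets `p` before `q`, where of two
points on the same ray the farther one counts as met first. -/
def SweptBefore (p q : K × K) : Prop :=
  0 < cross p q ∨ cross p q = 0 ∧ q.1 < p.1

/-- `v + s` is the vertex following `v` on the lower convex hull of `v` and `M`. -/
def IsHullStep (M : Finset (K × K)) (v s : K × K) : Prop :=
  v + s ∈ M ∧ ∀ p ∈ M, p ≠ v + s → SweptBefore s (p - v)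

theorem below_cons_of_le {v s p : K × K} (L : List (K × K)) (h : p.1 ≤ v.1 + s.1) :
    Below v (s :: L) p ↔ 0 < cross (p - v) s := by
  rw [Below, if_pos h]

theorem below_cons_of_lt {v s p : K × K} (L : List (K × K)) (h : v.1 + s.1 < p.1) :
    Below v (s :: L) p ↔ Below (v + s) L p := by
  rw [Below, if_neg h.not_ge]

variable {e v s p : K × K} {L : List (K × K)} {M N : Finset (K × K)}

namespace IsConvexPath

theorem ne_nil (h : IsConvexPath e M v L) : L ≠ [] := by
  cases h <;> exact List.cons_ne_nil _ _

theorem fst_pos (h : IsConvexPath e M v L) : ∀ s ∈ L, 0 < s.1 := by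
  induction h with
  | single hs _ => simpa using hs
  | cons hs _ _ _ ih => exact List.forall_mem_cons.2 ⟨hs, ih⟩

theorem start_add_sum (h : IsConvexPath e M v L) : v + L.sum = e := by
  induction h with
  | single _ he => simpa using he
  | cons _ _ _ _ ih => rw [List.sum_cons, ← add_assoc, ih]

theorem pairwise (h : IsConvexPath e M v L) : L.Pairwise fun p q => 0 < cross p q := by
  induction h with
  | single _ _ => exact List.pairwise_singleton _ _
  | cons _ _ hL _ ih => exact List.pairwise_cons.2 ⟨hL, ih⟩

theorem mono (h : IsConvexPath e M v L) (hMN : M ⊆ N) : IsConvexPath e N v L := by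
  induction h with
  | single hs he => exact .single hs he
  | cons hs hM hL _ ih => exact .cons hs (hMN hM) hL ih

end IsConvexPath

theorem IsHullStep.cross_nonneg (hs : IsHullStep M v s) (hp : p ∈ M) : 0 ≤ cross s (p - v) := by
  by_cases hps : p = v + s
  · simp [hps, cross_self]
  · exact (hs.2 p hp hps).elim le_of_lt fun h => h.1.ge

variable [IsStrictOrderedRing K]

theorem cross_pos_of_pos_of_nonneg {p q r : K × K} (hp : 0 ≤ p.1) (hq : 0 < q.1) (hr : 0 < r.1)
    (hpq : 0 < cross p q) (hqr : 0 ≤ cross q r) : 0 < cross p r := by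
  refine pos_of_mul_pos_right ?_ hq.le
  rw [mul_cross]
  positivity

theorem cross_pos_of_nonneg_of_pos {p q r : K × K} (hp : 0 < p.1) (hq : 0 < q.1) (hr : 0 ≤ r.1)
    (hpq : 0 ≤ cross p q) (hqr : 0 < cross q r) : 0 < cross p r := by
  refine pos_of_mul_pos_right ?_ hq.le
  rw [mul_cross]
  positivity

theorem cross_sum_pos (hne : L ≠ []) (hL : ∀ r ∈ L, 0 < cross s r) : 0 < cross s L.sum := by
  have hsum : cross s L.sum = (L.map (cross s)).sum :=
    map_list_sum (AddMonoidHom.mk' (cross s) (cross_add_right s)) L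
  rw [hsum]
  exact List.sum_pos _ (List.forall_mem_map.2 hL) (by simpa using hne)

theorem BelowChord.trans {w : K × K} (hw : BelowChord v e w) (hp : BelowChord w e p) :
    BelowChord v e p := by
  obtain ⟨hvw, hwe, hw⟩ := hw
  obtain ⟨hwp, hpe, hp⟩ := hp
  refine ⟨hvw.trans hwp, hpe, pos_of_mul_pos_right (a := e.1 - w.1) ?_ (sub_pos.2 hwe).le⟩
  have hdepth : (e.1 - w.1) * cross (p - v) (e - v) =
      (e.1 - p.1) * cross (w - v) (e - v) + (e.1 - v.1) * cross (p - w) (e - w) := by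
    simp only [cross, Prod.fst_sub, Prod.snd_sub]
    ring
  rw [hdepth]
  exact add_pos (mul_pos (sub_pos.2 hpe) hw) (mul_pos (sub_pos.2 (hvw.trans hwe)) hp)

theorem SweptBefore.trans {p q r : K × K} (hp : 0 < p.1) (hq : 0 < q.1) (hr : 0 < r.1)
    (hpq : SweptBefore p q) (hqr : SweptBefore q r) : SweptBefore p r := by
  rcases hpq with hpq | ⟨hpq, hqp⟩
  · exact .inl (cross_pos_of_pos_of_nonneg hp.le hq hr hpq (hqr.elim le_of_lt fun h => h.1.ge))
  · rcases hqr with hqr | ⟨hqr, hrq⟩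
    · exact .inl (cross_pos_of_nonneg_of_pos hp hq hr.le hpq.ge hqr)
    · refine .inr ⟨(mul_eq_zero.1 ?_).resolve_left hq.ne', hrq.trans hqp⟩
      rw [mul_cross, hpq, hqr, mul_zero, mul_zero, add_zero]

theorem sweptBefore_or_sweptBefore {p q : K × K} (hp : 0 < p.1) (hpq : p ≠ q) :
    SweptBefore p q ∨ SweptBefore q p := by
  rcases lt_trichotomy (cross p q) 0 with hlt | heq | hgt
  · exact .inr (.inl (by rwa [← neg_cross, neg_pos]))
  · have heq' : cross q p = 0 := by rw [← neg_cross, heq, neg_zero]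
    rcases lt_trichotomy p.1 q.1 with hlt | hfst | hgt
    · exact .inr (.inr ⟨heq', hlt⟩)
    · rw [cross, ← hfst, sub_eq_zero] at heq
      exact absurd (Prod.ext hfst (mul_left_cancel₀ hp.ne' heq).symm) hpq
    · exact .inl (.inr ⟨heq, hgt⟩)
  · exact .inl (.inl hgt)

theorem exists_isHullStep (hM : M.Nonempty) (hv : ∀ p ∈ M, v.1 < p.1) :
    ∃ s, IsHullStep M v s := by
  induction hM using Finset.Nonempty.cons_induction with
  | singleton a => exact ⟨a - v, by simp [IsHullStep]⟩
  | cons a M ha _ ih =>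
    obtain ⟨hva, hvM⟩ := (Finset.forall_mem_cons ha _).1 hv
    obtain ⟨s, hsM, hs⟩ := ih hvM
    have hs0 : 0 < s.1 := by simpa using hvM _ hsM
    have hne : s ≠ a - v := by rintro rfl; exact ha (by simpa using hsM)
    rcases sweptBefore_or_sweptBefore hs0 hne with hsa | has
    · exact ⟨s, Finset.mem_cons_of_mem hsM,
        (Finset.forall_mem_cons ha _).2 ⟨fun _ => hsa, hs⟩⟩
    · refine ⟨a - v, by simp, (Finset.forall_mem_cons ha _).2 ⟨by simp, fun p hp _ => ?_⟩⟩
      by_cases hps : p = v + s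
      · simpa [hps] using has
      · exact has.trans (sub_pos.2 hva) hs0 (sub_pos.2 (hvM p hp)) (hs p hp hps)

namespace IsConvexPath

theorem fst_lt (h : IsConvexPath e M v L) : v.1 < e.1 := by
  induction h with
  | single hs he => simpa [← he] using hs
  | cons hs _ _ _ ih => exact (lt_add_of_pos_right _ hs).trans ih

theorem cross_end_pos (h : IsConvexPath e M (v + s) L) (hL : ∀ r ∈ L, 0 < cross s r) :
    0 < cross s (e - v) := by
  rw [← cross_sub_add_self, ← h.start_add_sum, add_sub_cancel_left]
  exact cross_sum_pos h.ne_nil hL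

theorem belowChord_of_cons (h : IsConvexPath e M (v + s) L) (hs : 0 < s.1)
    (hL : ∀ r ∈ L, 0 < cross s r) : BelowChord v e (v + s) :=
  ⟨by simpa using hs, h.fst_lt, by simpa using h.cross_end_pos hL⟩

open Classical in
theorem filter_belowChord (h : IsConvexPath e M v L) :
    IsConvexPath e (M.filter (BelowChord v e)) v L := by
  induction h with
  | single hs he => exact .single hs he
  | @cons v s L hs hM hL h ih =>
    have hvs : BelowChord v e (v + s) := h.belowChord_of_cons hs hL
    refine .cons hs (Finset.mem_filter.2 ⟨hM, hvs⟩) hL (ih.mono fun p hp => ?_)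
    rw [Finset.mem_filter] at hp ⊢
    exact ⟨hp.1, hvs.trans hp.2⟩

theorem filter_cross_pos (h : IsConvexPath e M v L) (hL : ∀ r ∈ L, 0 < cross s r) :
    IsConvexPath e (M.filter fun p => 0 < cross s (p - v)) v L := by
  induction h with
  | single hr he => exact .single hr he
  | @cons v r L hr hM hrL _ ih =>
    obtain ⟨hsr, hsL⟩ := List.forall_mem_cons.1 hL
    refine .cons hr (Finset.mem_filter.2 ⟨hM, by simpa using hsr⟩) hrL
      ((ih hsL).mono fun p hp => ?_)
    rw [Finset.mem_filter] at hp ⊢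
    have hsplit : cross s (p - v) = cross s r + cross s (p - (v + r)) := by
      rw [← cross_add_right]
      congr 1
      abel
    exact ⟨hp.1, hsplit ▸ add_pos hsr hp.2⟩

theorem forall_cross_pos (h : IsConvexPath e M v L) (hs : 0 < s.1)
    (hM : ∀ p ∈ M, 0 < cross s (p - v)) (he : 0 < cross s (e - v)) :
    ∀ r ∈ L, 0 < cross s r := by
  cases h with
  | single hr he' => simpa [← he'] using he
  | @cons _ r L hr hrM hrL h =>
    have hsr : 0 < cross s r := by simpa using hM _ hrM
    exact List.forall_mem_cons.2 ⟨hsr, fun r' hr' =>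
      cross_pos_of_pos_of_nonneg hs.le hr (h.fst_pos r' hr') hsr (hrL r' hr').le⟩

theorem belowChord_of_below (h : IsConvexPath e M v L) (hv : v.1 < p.1) (he : p.1 < e.1)
    (hp : Below v L p) : BelowChord v e p := by
  induction h with
  | @single v s _ hse =>
    subst hse
    refine ⟨hv, he, ?_⟩
    rw [below_cons_of_le _ he.le] at hp
    simpa using hp
  | @cons v s L hs _ hL h ih =>
    rcases le_or_gt p.1 (v.1 + s.1) with hps | hps
    · rw [below_cons_of_le _ hps] at hp
      exact ⟨hv, he, cross_pos_of_pos_of_nonneg (sub_pos.2 hv).le hs (sub_pos.2 (hv.trans he)) hp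
        (h.cross_end_pos hL).le⟩
    · rw [below_cons_of_lt _ hps] at hp
      exact (h.belowChord_of_cons hs hL).trans (ih hps hp)

theorem below_of_forall_cross_pos (h : IsConvexPath e M v L) (hv : v.1 < p.1) (he : p.1 ≤ e.1)
    (hp : ∀ r ∈ L, 0 < cross (p - v) r) : Below v L p := by
  induction h with
  | @single v s _ hse =>
    subst hse
    exact (below_cons_of_le _ he).2 (hp s (List.mem_singleton_self s))
  | @cons v s L hs _ hL h ih =>
    obtain ⟨hps, -⟩ := List.forall_mem_cons.1 hp
    rcases le_or_gt p.1 (v.1 + s.1) with hle | hlt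
    · exact (below_cons_of_le _ hle).2 hps
    · refine (below_cons_of_lt _ hlt).2 (ih hlt fun r hr => ?_)
      have hps' : 0 < cross (p - (v + s)) s := by
        rwa [← neg_cross, cross_sub_add_self, neg_cross]
      exact cross_pos_of_pos_of_nonneg (sub_pos.2 hlt).le hs (h.fst_pos r hr) hps' (hL r hr).le

end IsConvexPath

namespace IsHullStep

theorem cross_pos (hs : IsHullStep M v s) (hp : p ∈ M) (hlt : (v + s).1 < p.1) :
    0 < cross s (p - v) := by
  refine (hs.2 p hp (by rintro rfl; exact hlt.false)).resolve_right fun h => ?_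
  exact hlt.not_gt (sub_lt_iff_lt_add'.1 h.2)

open Classical in
theorem isConvexPath_cons_iff (hs : IsHullStep M v s) (hse : BelowChord v e (v + s)) :
    IsConvexPath e M v (s :: L) ↔
      IsConvexPath e (M.filter (BelowChord (v + s) e)) (v + s) L := by
  have hs0 : 0 < s.1 := by simpa using hse.1
  constructor
  · intro h
    cases h with
    | single _ he => exact absurd hse.2.1 (by simp [he])
    | cons _ _ _ h => exact h.filter_belowChord
  · intro h
    refine .cons hs0 hs.1 (h.forall_cross_pos hs0 (fun p hp => ?_) ?_)
      (h.mono fun p hp => (Finset.mem_filter.1 hp).1)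
    · obtain ⟨hpM, hp⟩ := Finset.mem_filter.1 hp
      rw [cross_sub_add_self]
      exact hs.cross_pos hpM hp.1
    · simpa [cross_sub_add_self] using hse.2.2

theorem isConvexPath_erase_iff (hs : IsHullStep M v s) (hse : BelowChord v e (v + s)) :
    IsConvexPath e (M.erase (v + s)) v L ↔ IsConvexPath e M v L ∧ ∀ L', L ≠ s :: L' := by
  constructor
  · refine fun h => ⟨h.mono fun p hp => Finset.mem_of_mem_erase hp, ?_⟩
    rintro L' rfl
    cases h with
    | single _ he => exact hse.2.1.ne (by rw [he])
    | cons _ hM _ _ => exact Finset.notMem_erase _ _ hM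
  · rintro ⟨h, hL⟩
    cases h with
    | single hr he => exact .single hr he
    | @cons _ r L hr hrM hrL h =>
      have hrs : v + r ≠ v + s := fun heq => hL L (by rw [add_left_cancel heq])
      refine .cons hr (Finset.mem_erase.2 ⟨hrs, hrM⟩) hrL
        ((h.filter_cross_pos hrL).mono fun p hp => ?_)
      obtain ⟨hpM, hp⟩ := Finset.mem_filter.1 hp
      refine Finset.mem_erase.2 ⟨?_, hpM⟩
      rintro rfl
      have hsr : 0 ≤ cross s r := by simpa using hs.cross_nonneg hrM
      rw [cross_sub_add_self, add_sub_cancel_left, ← neg_cross] at hp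
      linarith

open Classical in
theorem convexPaths_eq (hs : IsHullStep M v s) (hse : BelowChord v e (v + s)) :
    convexPaths e M v =
      List.cons s '' convexPaths e (M.filter (BelowChord (v + s) e)) (v + s) ∪
        convexPaths e (M.erase (v + s)) v := by
  ext L
  simp only [convexPaths, Set.mem_union, Set.mem_image, Set.mem_ofPred_eq,
    hs.isConvexPath_erase_iff hse, ← hs.isConvexPath_cons_iff hse]
  constructor
  · intro h
    by_cases hL : ∃ L', s :: L' = L
    · obtain ⟨L', rfl⟩ := hL
      exact .inl ⟨L', h, rfl⟩
    · exact .inr ⟨h, fun L' hL' => hL ⟨L', hL'.symm⟩⟩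
  · rintro (⟨L', h, rfl⟩ | ⟨h, -⟩) <;> exact h

theorem disjoint_convexPaths (hs : IsHullStep M v s) (hse : BelowChord v e (v + s))
    (S : Set (List (K × K))) : Disjoint (List.cons s '' S) (convexPaths e (M.erase (v + s)) v) := by
  rw [Set.disjoint_left]
  rintro _ ⟨L, -, rfl⟩ h
  exact ((hs.isConvexPath_erase_iff hse).1 h).2 L rfl

theorem below_cons_iff (hs : IsHullStep M v s) (h : IsConvexPath e N (v + s) L) (hp : p ∈ M)
    (he : p.1 < e.1) :
    Below v (s :: L) p ↔ BelowChord (v + s) e p ∧ Below (v + s) L p := by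
  rcases le_or_gt p.1 (v.1 + s.1) with hle | hlt
  · rw [below_cons_of_le _ hle, ← neg_cross, neg_pos]
    exact iff_of_false (hs.cross_nonneg hp).not_gt fun h => hle.not_gt h.1.1
  · rw [below_cons_of_lt _ hlt]
    exact ⟨fun hb => ⟨h.belowChord_of_below hlt he hb, hb⟩, And.right⟩

theorem below_of_isConvexPath_erase (hs : IsHullStep M v s) (hse : BelowChord v e (v + s))
    (h : IsConvexPath e (M.erase (v + s)) v L) : Below v L (v + s) := by
  cases h with
  | @single _ r hr he =>
    subst he
    exact (below_cons_of_le _ hse.2.1.le).2 (by simpa using hse.2.2)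
  | @cons _ r L hr hrM hrL h =>
    obtain ⟨hne, hrM⟩ := Finset.mem_erase.1 hrM
    have hsr : SweptBefore s r := by simpa using hs.2 _ hrM hne
    rcases le_or_gt (v + s).1 (v.1 + r.1) with hle | hlt
    · rw [below_cons_of_le _ hle, add_sub_cancel_left]
      exact hsr.resolve_right fun h => (add_le_add_iff_left _).1 hle |>.not_gt h.2
    · rw [below_cons_of_lt _ hlt]
      refine h.below_of_forall_cross_pos hlt hse.2.1.le fun r' hr' => ?_
      refine cross_pos_of_nonneg_of_pos (sub_pos.2 hlt) hr (h.fst_pos r' hr').le ?_ (hrL r' hr')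
      rw [← neg_cross, cross_sub_add_self, neg_cross, add_sub_cancel_left]
      exact hsr.elim le_of_lt fun h => h.1.ge

end IsHullStep

variable {R : Type*} [CommRing R]

open Classical in
/-- If every point of `M` is chosen independently with probability `1 - t`, this is the probability
that `L` is the lower convex hull of the chosen points and the end points: the inner vertices of
`L` are chosen, and the points below it are not. -/
noncomputable def hullProb (t : R) (M : Finset (K × K)) (v : K × K) (L : List (K × K)) : R :=
  (1 - t) ^ (L.length - 1) * t ^ (M.filter (Below v L)).card

open Classical in
theorem hullProb_cons (t : R) (hs : IsHullStep M v s) (hM : ∀ p ∈ M, p.1 < e.1)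
    (h : IsConvexPath e N (v + s) L) :
    hullProb t M v (s :: L) =
      (1 - t) * hullProb t (M.filter (BelowChord (v + s) e)) (v + s) L := by
  have hbelow : M.filter (Below v (s :: L)) =
      (M.filter (BelowChord (v + s) e)).filter (Below (v + s) L) := by
    rw [Finset.filter_filter]
    exact Finset.filter_congr fun p hp => hs.below_cons_iff h hp (hM p hp)
  have hlen : (s :: L).length - 1 = L.length - 1 + 1 :=
    (Nat.sub_add_cancel (List.length_pos_iff.2 h.ne_nil)).symm
  rw [hullProb, hullProb, hbelow, hlen, pow_succ']
  ring

theorem hullProb_erase (t : R) (hs : IsHullStep M v s) (hse : BelowChord v e (v + s))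
    (h : IsConvexPath e (M.erase (v + s)) v L) :
    hullProb t M v L = t * hullProb t (M.erase (v + s)) v L := by
  classical
  have hmem : v + s ∈ M.filter (Below v L) :=
    Finset.mem_filter.2 ⟨hs.1, hs.below_of_isConvexPath_erase hse h⟩
  rw [hullProb, hullProb, Finset.filter_erase, ← Finset.card_erase_add_one hmem, pow_succ']
  ring

theorem convexPaths_empty (hv : v.1 < e.1) : convexPaths e ∅ v = {[e - v]} := by
  ext L
  constructor
  · rintro (⟨hs, rfl⟩ | ⟨hs, hM, -, -⟩)
    · simp
    · simp at hM
  · rintro rfl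
    exact .single (sub_pos.2 hv) (add_sub_cancel _ _)

theorem finite_convexPaths_and_finsum_hullProb (t : R) (hv : v.1 < e.1)
    (hM : ∀ p ∈ M, BelowChord v e p) :
    (convexPaths e M v).Finite ∧ ∑ᶠ L ∈ convexPaths e M v, hullProb t M v L = 1 := by
  classical
  induction M using Finset.strongInduction generalizing v with
  | H M ih =>
  rcases M.eq_empty_or_nonempty with rfl | hne
  · simp [convexPaths_empty hv, hullProb]
  obtain ⟨s, hs⟩ := exists_isHullStep hne fun p hp => (hM p hp).1
  have hse : BelowChord v e (v + s) := hM _ hs.1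
  have hsub : M.filter (BelowChord (v + s) e) ⊂ M :=
    Finset.filter_ssubset.2 ⟨v + s, hs.1, fun h => h.1.false⟩
  obtain ⟨hfin, hsum⟩ := ih _ hsub hse.2.1 fun p hp => (Finset.mem_filter.1 hp).2
  obtain ⟨hfin', hsum'⟩ := ih _ (Finset.erase_ssubset hs.1) hv fun p hp =>
    hM p (Finset.mem_of_mem_erase hp)
  rw [hs.convexPaths_eq hse]
  refine ⟨(hfin.image _).union hfin', ?_⟩
  calc _ = ∑ᶠ L ∈ convexPaths e (M.filter (BelowChord (v + s) e)) (v + s),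
          (1 - t) * hullProb t (M.filter (BelowChord (v + s) e)) (v + s) L +
        ∑ᶠ L ∈ convexPaths e (M.erase (v + s)) v, t * hullProb t (M.erase (v + s)) v L := by
        rw [finsum_mem_union (hs.disjoint_convexPaths hse _) (hfin.image _) hfin',
          finsum_mem_image List.cons_injective.injOn]
        exact congrArg₂ _
          (finsum_mem_congr rfl fun L hL => hullProb_cons t hs (fun p hp => (hM p hp).2.1) hL)
          (finsum_mem_congr rfl fun L hL => hullProb_erase t hs hse hL)
    _ = (1 - t) * 1 + t * 1 := by
        rw [← mul_finsum_mem' _ _ hfin, ← mul_finsum_mem' _ _ hfin', hsum, hsum']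
    _ = 1 := by ring

end ConvexPaths

section LatticePoints

theorem card_filter_dvd_mul_add_one {a : ℕ} (ha : 0 < a) (c : ℕ) :
    ((Finset.range a).filter fun m => a ∣ c * (m + 1)).card = a.gcd c := by
  obtain ⟨g, a', c', hg, hcop, rfl, rfl⟩ := Nat.exists_coprime' (m := a) (n := c)
    (Nat.gcd_pos_of_pos_left c ha)
  have hdvd : ∀ m, a' * g ∣ c' * g * (m + 1) ↔ a' ∣ m + 1 := fun m => by
    rw [mul_right_comm, Nat.mul_dvd_mul_iff_right hg, hcop.dvd_mul_left]
  simp only [hdvd]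
  rw [Nat.card_multiples, Nat.gcd_mul_right, hcop.gcd_eq_one, one_mul,
    Nat.mul_div_cancel_left _ (pos_of_mul_pos_left ha g.zero_le)]

/-- The ceiling `⌈x / a⌉`, expressed by the floor division of integers. -/
def ceilDiv (x a : ℤ) : ℤ := -(-x / a)

theorem lt_ceilDiv_iff {a x y : ℤ} (ha : 0 < a) : y < ceilDiv x a ↔ y * a < x := by
  rw [ceilDiv, lt_neg, Int.ediv_lt_iff_lt_mul ha, neg_mul, neg_lt_neg_iff]

theorem ceilDiv_mul_self {a : ℤ} (ha : a ≠ 0) (c : ℤ) : ceilDiv (c * a) a = c := by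
  rw [ceilDiv, ← neg_mul, Int.mul_ediv_cancel _ ha, neg_neg]

theorem ceilDiv_add_ceilDiv {a : ℤ} (ha : 0 < a) (c m : ℤ) :
    ceilDiv (c * m) a + ceilDiv (c * (a - m)) a = c + 1 - if a ∣ c * m then 1 else 0 := by
  have hreflect : -(c * (a - m)) = c * m + a * (-c) := by ring
  rw [ceilDiv, ceilDiv, hreflect, Int.add_mul_ediv_left _ _ ha.ne', Int.neg_ediv,
    Int.sign_eq_one_of_pos ha]
  split_ifs <;> ring

theorem two_mul_sum_ceilDiv {a : ℕ} (ha : 0 < a) (c : ℕ) :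
    2 * ∑ m ∈ Finset.range a, ceilDiv (c * (m + 1)) a = a * c + a + c - a.gcd c := by
  have hshift : ∑ m ∈ Finset.range a, ceilDiv (c * (m + 1)) a =
      ∑ m ∈ Finset.range a, ceilDiv (c * m) a + c := by
    have h := Finset.sum_range_succ' (fun m : ℕ => ceilDiv (c * m) a) a
    rw [Finset.sum_range_succ, ceilDiv_mul_self (by exact_mod_cast ha.ne')] at h
    simpa [ceilDiv] using h.symm
  have hreflect : ∑ m ∈ Finset.range a, ceilDiv (c * m) a =
      ∑ m ∈ Finset.range a, ceilDiv (c * (a - (m + 1))) a := by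
    rw [← Finset.sum_range_reflect]
    refine Finset.sum_congr rfl fun m hm => ?_
    rw [Nat.sub_sub, Nat.cast_sub (by grind), add_comm]
    simp
  have hpair : ∑ m ∈ Finset.range a, ceilDiv (c * (m + 1)) a +
      ∑ m ∈ Finset.range a, ceilDiv (c * m) a = a * (c + 1) - a.gcd c := by
    rw [hreflect, ← Finset.sum_add_distrib]
    simp only [ceilDiv_add_ceilDiv (Nat.cast_pos.2 ha)]
    rw [Finset.sum_sub_distrib, Finset.sum_boole, ← card_filter_dvd_mul_add_one ha]
    simp only [Finset.sum_const, Finset.card_range, nsmul_eq_mul]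
    norm_cast
  linarith

variable {e v s p : ℤ × ℤ} {L : List (ℤ × ℤ)} {M : Finset (ℤ × ℤ)}

open Classical in
theorem card_below_cons {m n : ℤ} (hs : 0 < s.1) (hs' : 0 < s.2) (hv : 0 ≤ v.2) (hm : 0 < m)
    (hms : m ≤ s.1) (hn : (v + s).2 ≤ n) :
    (((Finset.Ioo 0 n).filter fun y => Below v (s :: L) (v.1 + m, y)).card : ℤ) =
      v.2 + ceilDiv (s.2 * m) s.1 - 1 := by
  have hpos : 0 < ceilDiv (s.2 * m) s.1 := (lt_ceilDiv_iff hs).2 (by rw [zero_mul]; positivity)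
  have hle : ceilDiv (s.2 * m) s.1 ≤ s.2 :=
    not_lt.1 fun h => ((lt_ceilDiv_iff hs).1 h).not_ge (by gcongr)
  have hbelow : ∀ y, Below v (s :: L) (v.1 + m, y) ↔ y < v.2 + ceilDiv (s.2 * m) s.1 := by
    intro y
    rw [below_cons_of_le _ (by simpa using hms), ← sub_lt_iff_lt_add', lt_ceilDiv_iff hs,
      mul_comm s.2, mul_comm _ s.1]
    simp only [cross, Prod.fst_sub, Prod.snd_sub, add_sub_cancel_left, sub_pos]
  rw [Prod.snd_add] at hn
  simp only [hbelow]
  rw [Finset.Ioo_filter_lt, min_eq_right (by linarith), Int.card_Ioo,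
    Int.toNat_of_nonneg (by linarith)]
  ring

theorem sum_Ioc_add_natCast (f : ℤ → ℤ) (x : ℤ) (a : ℕ) :
    ∑ y ∈ Finset.Ioc x (x + a), f y = ∑ m ∈ Finset.range a, f (x + (m + 1)) := by
  rw [Int.Ioc_eq_finset_map, Finset.sum_map]
  simp [add_left_comm, add_comm]

open Classical in
theorem two_mul_sum_card_below_cons {n : ℤ} (hs : 0 < s.1) (hs' : 0 < s.2) (hv : 0 ≤ v.2)
    (hn : (v + s).2 ≤ n) :
    2 * ∑ x ∈ Finset.Ioc v.1 (v + s).1,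
        (((Finset.Ioo 0 n).filter fun y => Below v (s :: L) (x, y)).card : ℤ) =
      2 * s.1 * v.2 + s.1 * s.2 - s.1 + s.2 - s.1.gcd s.2 := by
  obtain ⟨a, ha⟩ := Int.eq_ofNat_of_zero_le hs.le
  obtain ⟨c, hc⟩ := Int.eq_ofNat_of_zero_le hs'.le
  have hcolumn : ∀ m ∈ Finset.range a,
      (((Finset.Ioo 0 n).filter fun y => Below v (s :: L) (v.1 + (m + 1), y)).card : ℤ) =
        v.2 - 1 + ceilDiv (c * (m + 1)) a := fun m hm => by
    rw [card_below_cons hs hs' hv (by positivity) (by grind) hn, ha, hc]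
    ring
  have hceil := two_mul_sum_ceilDiv (by omega : 0 < a) c
  rw [Prod.fst_add, ha, sum_Ioc_add_natCast, Finset.sum_congr rfl hcolumn, Finset.sum_add_distrib,
    Finset.sum_const, Finset.card_range, mul_add, hceil, hc, Int.gcd_natCast_natCast, nsmul_eq_mul]
  ring

theorem IsConvexPath.snd_lt (h : IsConvexPath e M v L) (hL : ∀ s ∈ L, 0 < s.2) : v.2 < e.2 := by
  induction h with
  | single _ he => simpa [← he] using hL
  | cons _ _ _ _ ih =>
    obtain ⟨hs, hL⟩ := List.forall_mem_cons.1 hL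
    exact (lt_add_of_pos_right _ hs).trans (ih hL)

/-- The sum of the cross products of all pairs of vectors, in the order of the list. -/
def crossSum : List (ℤ × ℤ) → ℤ
  | [] => 0
  | s :: L => cross s L.sum + crossSum L

/-- The sum of the lattice lengths of the vectors. -/
def gcdSum (L : List (ℤ × ℤ)) : ℤ :=
  (L.map fun s => (s.1.gcd s.2 : ℤ)).sum

open Classical in
theorem IsConvexPath.two_mul_sum_card_below (h : IsConvexPath e M v L) (hL : ∀ s ∈ L, 0 < s.2)
    (hv : 0 ≤ v.2) :
    2 * ∑ x ∈ Finset.Ioc v.1 e.1,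
        (((Finset.Ioo 0 e.2).filter fun y => Below v L (x, y)).card : ℤ) =
      (e.1 - v.1) * (e.2 + v.2) - (e.1 - v.1) + (e.2 - v.2) - crossSum L - gcdSum L := by
  induction h with
  | @single v s hs he =>
    subst he
    have hs' : 0 < s.2 := hL s (List.mem_singleton_self s)
    rw [two_mul_sum_card_below_cons (n := (v + s).2) hs hs' hv le_rfl]
    simp only [crossSum, gcdSum, cross, List.sum_nil, List.map_cons, List.map_nil,
      List.sum_cons, Prod.fst_add, Prod.snd_add, Prod.fst_zero, Prod.snd_zero]
    ring
  | @cons v s L hs _ _ h ih =>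
    obtain ⟨hs', hL⟩ := List.forall_mem_cons.1 hL
    have hfirst := two_mul_sum_card_below_cons (L := L) hs hs' hv (h.snd_lt hL).le
    have hrest : ∀ x ∈ Finset.Ioc (v + s).1 e.1,
        (((Finset.Ioo 0 e.2).filter fun y => Below v (s :: L) (x, y)).card : ℤ) =
          ((Finset.Ioo 0 e.2).filter fun y => Below (v + s) L (x, y)).card := fun x hx => by
      simp only [below_cons_of_lt (p := (x, _)) L (Finset.mem_Ioc.1 hx).1]
    have hsum : v + s + L.sum = e := h.start_add_sum
    rw [← Finset.Ioc_union_Ioc_eq_Ioc (b := (v + s).1) (by simpa using hs.le) h.fst_lt.le,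
      Finset.sum_union (Finset.Ioc_disjoint_Ioc_of_le le_rfl), mul_add, hfirst,
      Finset.sum_congr rfl hrest, ih hL (by simpa using add_nonneg hv hs'.le), ← hsum]
    simp only [crossSum, gcdSum, cross, List.map_cons, List.sum_cons, Prod.fst_add, Prod.snd_add]
    ring

theorem IsConvexPath.below_iff_snd_lt (h : IsConvexPath e M v L) (hp : p.1 = e.1) :
    Below v L p ↔ p.2 < e.2 := by
  induction h with
  | @single v s hs he =>
    have hcross : cross (p - v) s = s.1 * (e.2 - p.2) := by
      simp only [cross, Prod.fst_sub, Prod.snd_sub, hp, ← he, Prod.fst_add, Prod.snd_add]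
      ring
    rw [below_cons_of_le _ (by rw [hp, ← he, Prod.fst_add]), hcross, mul_pos_iff_of_pos_left hs,
      sub_pos]
  | @cons v s L _ _ _ h ih => rwa [below_cons_of_lt _ (hp ▸ h.fst_lt)]

open Classical in
/-- The lattice points in the interior of the triangle with vertices `0`, `(e.1, 0)` and `e`. -/
noncomputable def triangle (e : ℤ × ℤ) : Finset (ℤ × ℤ) :=
  (Finset.Ioo 0 e.1 ×ˢ Finset.Ioo 0 e.2).filter (BelowChord 0 e)

theorem mem_triangle_iff :
    p ∈ triangle e ↔ ((0 < p.1 ∧ p.1 < e.1) ∧ 0 < p.2 ∧ p.2 < e.2) ∧ BelowChord 0 e p := by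
  classical
  rw [triangle, Finset.mem_filter, Finset.mem_product, Finset.mem_Ioo, Finset.mem_Ioo]

open Classical in
theorem IsConvexPath.card_filter_below_triangle (h : IsConvexPath e M 0 L) :
    ((triangle e).filter (Below 0 L)).card =
      ∑ x ∈ Finset.Ioo 0 e.1, ((Finset.Ioo 0 e.2).filter fun y => Below 0 L (x, y)).card := by
  have hbelow : (triangle e).filter (Below 0 L) =
      (Finset.Ioo 0 e.1 ×ˢ Finset.Ioo 0 e.2).filter (Below 0 L) := by
    rw [triangle, Finset.filter_filter]
    refine Finset.filter_congr fun p hp => and_iff_right_of_imp (h.belowChord_of_below ?_ ?_)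
    · exact (Finset.mem_Ioo.1 (Finset.mem_product.1 hp).1).1
    · exact (Finset.mem_Ioo.1 (Finset.mem_product.1 hp).1).2
  rw [hbelow, Finset.card_filter, Finset.sum_product]
  simp only [← Finset.card_filter]

open Classical in
theorem IsConvexPath.two_mul_card_filter_below_triangle (h : IsConvexPath e M 0 L)
    (hL : ∀ s ∈ L, 0 < s.2) :
    2 * (((triangle e).filter (Below 0 L)).card : ℤ) =
      e.1 * e.2 - e.1 - e.2 + 2 - crossSum L - gcdSum L := by
  have he : 0 < e.1 := h.fst_lt
  have he' : 0 < e.2 := h.snd_lt hL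
  have hlast : (((Finset.Ioo 0 e.2).filter fun y => Below 0 L (e.1, y)).card : ℤ) = e.2 - 1 := by
    simp only [h.below_iff_snd_lt]
    rw [Finset.Ioo_filter_lt, min_self, Int.card_Ioo, Int.toNat_of_nonneg (by linarith), sub_zero]
  have hcolumns := h.two_mul_sum_card_below hL le_rfl
  rw [Prod.fst_zero, Prod.snd_zero, ← Finset.Ioo_insert_right he,
    Finset.sum_insert Finset.right_notMem_Ioo, hlast] at hcolumns
  rw [h.card_filter_below_triangle]
  push_cast
  linarith

theorem isConvexPath_box_of_pairwise (hne : L ≠ []) (hL : ∀ s ∈ L, 0 < s.1 ∧ 0 < s.2)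
    (hv : 0 ≤ v.1) (hv' : 0 ≤ v.2) (he : v + L.sum = e)
    (hcross : L.Pairwise fun p q => 0 < cross p q) :
    IsConvexPath e (Finset.Ioo 0 e.1 ×ˢ Finset.Ioo 0 e.2) v L := by
  induction L generalizing v with
  | nil => exact absurd rfl hne
  | cons s L ih =>
    obtain ⟨⟨hs, hs'⟩, hL⟩ := List.forall_mem_cons.1 hL
    obtain ⟨hsL, hcross⟩ := List.pairwise_cons.1 hcross
    rcases eq_or_ne L [] with rfl | hne
    · exact .single hs (by simpa using he)
    · have hvs : 0 < (v + s).1 := add_pos_of_nonneg_of_pos hv hs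
      have hvs' : 0 < (v + s).2 := add_pos_of_nonneg_of_pos hv' hs'
      have h := ih hne hL hvs.le hvs'.le (by rw [← he, List.sum_cons, add_assoc]) hcross
      exact .cons hs (Finset.mem_product.2 ⟨Finset.mem_Ioo.2 ⟨hvs, h.fst_lt⟩,
        Finset.mem_Ioo.2 ⟨hvs', h.snd_lt fun r hr => (hL r hr).2⟩⟩) hsL h

theorem IsConvexPath.snd_pos (h : IsConvexPath e (triangle e) 0 L) (he : 0 < e.2) :
    ∀ s ∈ L, 0 < s.2 := by
  cases h with
  | single _ hse => simpa [← hse] using he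
  | @cons _ s L hs hM hL h =>
    have hs' : 0 < s.2 := by
      rw [zero_add, mem_triangle_iff] at hM
      exact hM.1.2.1
    refine List.forall_mem_cons.2 ⟨hs', fun r hr => pos_of_mul_pos_right ?_ hs.le⟩
    exact (mul_pos (h.fst_pos r hr) hs').trans (sub_pos.1 (hL r hr))

theorem isConvexPath_triangle_iff (he : 0 < e.2) :
    IsConvexPath e (triangle e) 0 L ↔
      L ≠ [] ∧ (∀ s ∈ L, 0 < s.1 ∧ 0 < s.2) ∧ L.sum = e ∧ L.Pairwise fun p q => 0 < cross p q := by
  constructor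
  · intro h
    exact ⟨h.ne_nil, fun s hs => ⟨h.fst_pos s hs, h.snd_pos he s hs⟩,
      by simpa using h.start_add_sum, h.pairwise⟩
  · rintro ⟨hne, hL, hsum, hcross⟩
    exact (isConvexPath_box_of_pairwise hne hL le_rfl le_rfl (by rwa [zero_add])
      hcross).filter_belowChord

end LatticePoints

section Slopes

/-- The shear that turns a pair `(a, b)` of slope `a / b < 1` into a vector with positive
coordinates. -/
def shear (p : ℕ × ℕ) : ℤ × ℤ := (p.1, p.2 - p.1)

theorem cross_shear (p q : ℕ × ℕ) : cross (shear p) (shear q) = p.1 * q.2 - q.1 * p.2 := by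
  simp only [cross, shear]
  ring

theorem shear_injective : Function.Injective shear := fun p q h => by
  simp only [shear, Prod.mk.injEq, Nat.cast_inj] at h
  exact Prod.ext h.1 (by have := h.1; omega)

theorem exists_shear_eq {p : ℤ × ℤ} (hp : 0 < p.1 ∧ 0 < p.2) : ∃ q, shear q = p :=
  ⟨(p.1.toNat, (p.1 + p.2).toNat), Prod.ext (by simp [shear]; omega) (by simp [shear]; omega)⟩

/-- The list of sheared vectors of a finite sequence of pairs. -/
def steps (s : Σ k : ℕ, Fin k → ℕ × ℕ) : List (ℤ × ℤ) :=
  (List.ofFn s.2).map shear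

theorem steps_eq_ofFn (s : Σ k : ℕ, Fin k → ℕ × ℕ) :
    steps s = List.ofFn fun l => shear (s.2 l) :=
  List.map_ofFn

theorem length_steps (s : Σ k : ℕ, Fin k → ℕ × ℕ) : (steps s).length = s.1 := by
  rw [steps, List.length_map, List.length_ofFn]

theorem steps_injective : Function.Injective steps :=
  (List.map_injective_iff.2 shear_injective).comp List.equivSigmaTuple.symm.injective

theorem exists_steps_eq {L : List (ℤ × ℤ)} (hL : ∀ p ∈ L, 0 < p.1 ∧ 0 < p.2) :
    ∃ s, steps s = L := by
  have hrange : L ∈ Set.range (List.map shear) := by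
    rw [Set.range_list_map]
    exact fun p hp => exists_shear_eq (hL p hp)
  obtain ⟨L, rfl⟩ := hrange
  exact ⟨List.equivSigmaTuple L, congrArg _ (List.equivSigmaTuple.symm_apply_apply L)⟩

theorem sum_steps (s : Σ k : ℕ, Fin k → ℕ × ℕ) :
    (steps s).sum = shear (∑ l, (s.2 l).1, ∑ l, (s.2 l).2) := by
  rw [steps_eq_ofFn, List.sum_ofFn]
  ext <;> simp [shear, Prod.fst_sum, Prod.snd_sum]

theorem mem_D_iff {i n k : ℕ} {s : Fin k → ℕ × ℕ} :
    s ∈ D i n k ↔ (∀ l, 0 < (s l).1 ∧ (s l).1 < (s l).2) ∧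
      (∑ l, (s l).1 = i ∧ ∑ l, (s l).2 = n) ∧
      ∀ ⦃l l'⦄, l < l' → (s l').1 * (s l).2 < (s l).1 * (s l').2 := by
  have hslope : (∀ l, 0 < (s l).2) →
      (StrictAnti (fun l => ((s l).1 : ℚ) / (s l).2) ↔
        ∀ ⦃l l'⦄, l < l' → (s l').1 * (s l).2 < (s l).1 * (s l').2) := fun hpos => by
    refine forall₃_congr fun l l' _ => ?_
    rw [div_lt_div_iff₀ (Nat.cast_pos.2 (hpos l')) (Nat.cast_pos.2 (hpos l))]
    norm_cast
  have hlt : ∀ l, 0 < (s l).2 → (((s l).1 : ℚ) / (s l).2 < 1 ↔ (s l).1 < (s l).2) := fun l hl => by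
    rw [div_lt_one (Nat.cast_pos.2 hl), Nat.cast_lt]
  constructor
  · rintro ⟨hpos, ha, hb, hanti, hbound⟩
    exact ⟨fun l => ⟨(hpos l).1, (hlt l (hpos l).2).1 (hbound l).2⟩, ⟨ha, hb⟩,
      (hslope fun l => (hpos l).2).1 hanti⟩
  · rintro ⟨hpos, ⟨ha, hb⟩, hcross⟩
    have hpos' : ∀ l, 0 < (s l).2 := fun l => (hpos l).1.trans (hpos l).2
    exact ⟨fun l => ⟨(hpos l).1, hpos' l⟩, ha, hb, (hslope hpos').2 hcross, fun l =>
      ⟨div_pos (Nat.cast_pos.2 (hpos l).1) (Nat.cast_pos.2 (hpos' l)),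
        (hlt l (hpos' l)).2 (hpos l).2⟩⟩

theorem mem_indexSet_iff {i n : ℕ} {s : Σ k : ℕ, Fin k → ℕ × ℕ} :
    s ∈ indexSet i n ↔ steps s ≠ [] ∧ (∀ p ∈ steps s, 0 < p.1 ∧ 0 < p.2) ∧
      (steps s).sum = shear (i, n) ∧ (steps s).Pairwise fun p q => 0 < cross p q := by
  rw [sum_steps, shear_injective.eq_iff, Prod.mk.injEq, ← List.length_pos_iff, length_steps,
    steps_eq_ofFn, List.forall_mem_ofFn_iff, List.pairwise_ofFn]
  simp only [cross_shear, sub_pos]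
  refine and_congr_right fun _ => mem_D_iff.trans ?_
  simp only [shear, sub_pos]
  norm_cast

theorem bijOn_steps {i n : ℕ} (hin : i < n) :
    Set.BijOn steps (indexSet i n) (convexPaths (shear (i, n)) (triangle (shear (i, n))) 0) := by
  have hpath : ∀ {L}, L ∈ convexPaths (shear (i, n)) (triangle (shear (i, n))) 0 ↔ _ :=
    isConvexPath_triangle_iff (by simpa [shear] using hin)
  refine ⟨fun s hs => hpath.2 (mem_indexSet_iff.1 hs), steps_injective.injOn, fun L hL => ?_⟩
  obtain ⟨s, rfl⟩ := exists_steps_eq (hpath.1 hL).2.1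
  exact ⟨s, mem_indexSet_iff.2 (hpath.1 hL), rfl⟩

theorem crossSum_ofFn {k : ℕ} (f : Fin k → ℤ × ℤ) :
    crossSum (List.ofFn f) = ∑ l, ∑ l' ∈ Finset.Ioi l, cross (f l) (f l') := by
  induction k with
  | zero => simp [crossSum]
  | succ k ih =>
    rw [List.ofFn_succ, crossSum, ih, Fin.sum_univ_succ, List.sum_ofFn, Fin.Ioi_zero_eq_map,
      Finset.sum_map]
    congr 1
    · exact map_sum (AddMonoidHom.mk' (cross (f 0)) (cross_add_right (f 0))) _ _
    · refine Finset.sum_congr rfl fun l _ => ?_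
      rw [← Fin.map_succEmb_Ioi, Finset.sum_map]
      rfl

theorem exponent_eq (s : Σ k : ℕ, Fin k → ℕ × ℕ) :
    exponent s.2 = 1 - s.1 + ((crossSum (steps s) + gcdSum (steps s) : ℤ) : ℚ) / 2 := by
  rw [exponent, steps_eq_ofFn, crossSum_ofFn, gcdSum, List.map_ofFn, List.sum_ofFn]
  simp only [cross_shear]
  simp [shear]

end Slopes

section Identity

variable {R : Type*} [CommRing R]

theorem sum_hullProb_steps {i n : ℕ} (hi : 0 < i) (hin : i < n) (t : R) :
    ∑ s ∈ (indexSet_finite i n).toFinset, hullProb t (triangle (shear (i, n))) 0 (steps s) = 1 := by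
  rw [← finsum_mem_eq_finite_toFinset_sum, finsum_mem_eq_of_bijOn steps (bijOn_steps hin)
    fun _ _ => rfl]
  exact (finite_convexPaths_and_finsum_hullProb t (by simpa [shear] using hi)
    fun p hp => (mem_triangle_iff.1 hp).2).2

open Multiplicative (ofAdd)

theorem term_eq_mul_hullProb {i n : ℕ} (hin : i < n) (f : Multiplicative ℚ →* R)
    {s : Σ k : ℕ, Fin k → ℕ × ℕ} (hs : s ∈ indexSet i n) :
    (f (ofAdd 1) - 1) ^ (s.1 - 1) * f (ofAdd (exponent s.2)) =
      f (ofAdd ((i * (n - i) - n : ℚ) / 2 + 1)) *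
        hullProb (f (ofAdd (-1))) (triangle (shear (i, n))) 0 (steps s) := by
  classical
  have hpath : IsConvexPath _ _ 0 (steps s) := (bijOn_steps hin).mapsTo hs
  have hcount := hpath.two_mul_card_filter_below_triangle
    (hpath.snd_pos (by simpa [shear] using hin))
  have hq : f (ofAdd 1) - 1 = f (ofAdd 1) * (1 - f (ofAdd (-1))) := by
    rw [mul_sub, mul_one, ← map_mul, ← ofAdd_add, add_neg_cancel, ofAdd_zero, f.map_one]
  have hpow : ∀ (m : ℕ) (r : ℚ), f (ofAdd r) ^ m = f (ofAdd (m * r)) := fun m r => by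
    rw [← map_pow, ← ofAdd_nsmul, nsmul_eq_mul]
  have hexp : (s.1 - 1 : ℕ) * 1 + exponent s.2 = (i * (n - i) - n : ℚ) / 2 + 1 +
      ((triangle (shear (i, n))).filter (Below 0 (steps s))).card * -1 := by
    have hcountQ := congrArg (Int.cast : ℤ → ℚ) hcount
    rw [exponent_eq, Nat.cast_sub hs.1]
    simp only [shear] at hcountQ ⊢
    push_cast at hcountQ ⊢
    linarith
  rw [hullProb, length_steps, hq, mul_pow, hpow, hpow, mul_right_comm, ← map_mul, ← ofAdd_add, hexp,
    ofAdd_add, map_mul, mul_right_comm, mul_assoc]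

end Identity

/-- The real power `q ^ r` of `q > 0` as a multiplicative function of the exponent `r ∈ ℚ`. -/
noncomputable def rpowHom {q : ℝ} (hq : 0 < q) : Multiplicative ℚ →* ℝ where
  toFun r := q ^ (r.toAdd : ℝ)
  map_one' := by simp
  map_mul' r r' := by rw [toAdd_mul, Rat.cast_add, Real.rpow_add hq]

end SlopeIdentity

open Multiplicative (ofAdd) in
theorem proposition1p1_general {R : Type*} [CommRing R] (f : Multiplicative ℚ →* R) (i n j : ℕ)
    (hi : 0 < i) (hin : i < n) (hj : j = n - i) :
    ∑ s ∈ (SlopeIdentity.indexSet_finite i n).toFinset,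
        (f (ofAdd 1) - 1) ^ (s.1 - 1) * f (ofAdd (SlopeIdentity.exponent s.2)) =
      f (ofAdd (((i : ℚ) * j - n) / 2 + 1)) := by
  have hj' : (j : ℚ) = n - i := by rw [hj, Nat.cast_sub hin.le]
  rw [hj', Finset.sum_congr rfl fun s hs => SlopeIdentity.term_eq_mul_hullProb hin f
      ((Set.Finite.mem_toFinset _).1 hs), ← Finset.mul_sum,
    SlopeIdentity.sum_hullProb_steps hi hin, mul_one]

theorem proposition1p1 (i n j : ℕ) (hi : 0 < i) (hin : i < n) (hj : j = n - i) :
    (∑ s ∈ (SlopeIdentity.indexSet_finite i n).toFinset,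
        (SlopeIdentity.qPow 1 - 1) ^ (s.1 - 1) *
          SlopeIdentity.qPow (SlopeIdentity.exponent s.2)) =
      SlopeIdentity.qPow (((i : ℚ) * (j : ℚ) - (n : ℚ)) / 2 + 1) ∧
    ∀ q : ℝ, 0 < q →
      (∑ s ∈ (SlopeIdentity.indexSet_finite i n).toFinset,
          (q - 1) ^ (s.1 - 1) * q ^ ((SlopeIdentity.exponent s.2 : ℚ) : ℝ)) =
        q ^ (((i : ℝ) * (j : ℝ) - (n : ℝ)) / 2 + 1) := by
  refine ⟨proposition1p1_general (AddMonoidAlgebra.of ℤ ℚ) i n j hi hin hj, fun q hq => ?_⟩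
  simpa [SlopeIdentity.rpowHom] using
    proposition1p1_general (SlopeIdentity.rpowHom hq) i n j hi hin hj
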